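/- Let $G$ be a simply connected (in particular connected) real Lie group of dimension $3$ whose Lie algebra $\mathfrak g$ is abelian (type $3\mathfrak g_1$), so that $G\cong\mathbb R^3$. A linear flow on $G$ is the flow $(\varphi_t)_{t\in\mathbb R}$ of a smooth vector field $\mathcal X$ on $G$ such that every $\varphi_t$ is an automorphism of the Lie group $G$. Its derivation is the linear map $\mathcal D:\mathfrak g\to\mathfrak g$, $\mathcal D(Y)=-[\mathcal X,Y]$, where $Y\in\mathfrak g$ is regarded as an invariant vector field and the bracket is evaluated at the identity. An orbit $t\mapsto\varphi_t(g)$ is called periodic if $g$ is not a fixed point of the flow and there is $T>0$ with $\varphi_{t+T}(g)=\varphi_t(g)$ for all $t\in\mathbb R$. 1. Let $\varphi_t$ be a linear flow on $G$ with derivation $\mathcal D$, and let $$\begin{pmatrix}x_1&x_2&x_3\\ y_1&y_2&y_3\\ z_1&z_2&z_3\end{pmatrix}$$ be the matrix of $\mathcal D$ in a basis $(E_1,E_2,E_3)$ of $\mathfrak g$, i.e. $\mathcal D(E_j)=x_jE_1+y_jE_2+z_jE_3$. If $\operatorname{tr}\mathcal D=\det\mathcal D=0$ and $$x_2y_1-x_1y_2+x_3z_1-x_1z_3+y_3z_2-y_2z_3<0,$$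 then $\varphi_t$ has a periodic orbit. 2. If $X$ is a (right or left) invariant vector field on $G$, then the flow of $X$ has no periodic orbit. -/

import Mathlib

open scoped Manifold ContDiff
open VectorField

/-- Orders of smoothness `minSmoothness ℝ n` with `n` finite lie below `∞`, so a smooth real Lie
group carries Mathlib's Lie bracket on `GroupLieAlgebra`. -/
instance instLEInftyMinSmoothnessReal : ENat.LEInfty (minSmoothness ℝ 3) where
  out := by
    rw [minSmoothness_of_isRCLikeNormedField]
    exact ENat.LEInfty.out

section Flows

variable {E : Type*} [NormedAddCommGroup E] [NormedSpace ℝ E]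
  {G : Type*} [TopologicalSpace G] [ChartedSpace E G]

/-- `φ` is the (global, smooth) flow of the smooth vector field `X`: the curves `t ↦ φ t g` are the
solutions of `ġ = X(g)` starting at `g`. -/
structure IsFlowOf [IsManifold 𝓘(ℝ, E) ∞ G]
    (X : (g : G) → TangentSpace 𝓘(ℝ, E) g) (φ : ℝ → G → G) : Prop where
  contMDiff_field :
    ContMDiff 𝓘(ℝ, E) 𝓘(ℝ, E).tangent ∞ (fun g : G ↦ (⟨g, X g⟩ : TangentBundle 𝓘(ℝ, E) G))
  contMDiff_flow :
    ContMDiff (𝓘(ℝ, ℝ).prod 𝓘(ℝ, E)) 𝓘(ℝ, E) ∞ (fun p : ℝ × G ↦ φ p.1 p.2)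
  map_zero : ∀ g, φ 0 g = g
  isMIntegralCurve : ∀ g, IsMIntegralCurve (fun t ↦ φ t g) X

/-- The orbit of `g` under `φ` is periodic: it closes up after some time `T > 0`, and `g` is not a
fixed point of the flow. -/
def IsPeriodicOrbit {G : Type*} (φ : ℝ → G → G) (g : G) : Prop :=
  (∃ T : ℝ, 0 < T ∧ ∀ t, φ (t + T) g = φ t g) ∧ ¬ ∀ t, φ t g = g

/-- The flow `φ` has a periodic orbit. -/
def HasPeriodicOrbit {G : Type*} (φ : ℝ → G → G) : Prop :=
  ∃ g, IsPeriodicOrbit φ g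

variable [Group G]

/-- `φ` is a linear flow, with linear vector field `X`: it is the flow of `X`, and each `φ t` is an
automorphism of the Lie group `G`. -/
structure IsLinearFlow [IsManifold 𝓘(ℝ, E) ∞ G]
    (X : (g : G) → TangentSpace 𝓘(ℝ, E) g) (φ : ℝ → G → G) : Prop
    extends IsFlowOf X φ where
  automorphism : ∀ t, ∃ Φ : G ≃* G, ContMDiff 𝓘(ℝ, E) 𝓘(ℝ, E) ∞ Φ ∧
    ContMDiff 𝓘(ℝ, E) 𝓘(ℝ, E) ∞ Φ.symm ∧ ∀ g, Φ g = φ t g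

/-- `X` is invariant under all right translations. -/
def IsRightInvariant (X : (g : G) → TangentSpace 𝓘(ℝ, E) g) : Prop :=
  ∀ g h : G, X (g * h) = mfderiv 𝓘(ℝ, E) 𝓘(ℝ, E) (· * h) g (X g)

/-- `X` is invariant under all left translations. -/
def IsLeftInvariant (X : (g : G) → TangentSpace 𝓘(ℝ, E) g) : Prop :=
  ∀ g h : G, X (g * h) = mfderiv 𝓘(ℝ, E) 𝓘(ℝ, E) (g * ·) h (X h)

/-- The map `Y ↦ -[X, Y]` on the Lie algebra of `G`, where `Y ∈ 𝔤 = T₁G` is regarded as an invariant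
vector field and the bracket of vector fields is evaluated at the identity. For a linear
vector field `X` this is its associated derivation `𝒟`. -/
noncomputable def fieldDerivation [CompleteSpace E] [LieGroup 𝓘(ℝ, E) ∞ G]
    (X : (g : G) → TangentSpace 𝓘(ℝ, E) g) :
    GroupLieAlgebra 𝓘(ℝ, E) G →ₗ[ℝ] GroupLieAlgebra 𝓘(ℝ, E) G where
  toFun Y := -mlieBracket 𝓘(ℝ, E) X (mulInvariantVectorField Y) (1 : G)
  map_add' Y Z := by
    rw [mulInvariantVectorField_add, mlieBracket_add_right
      (mdifferentiableAt_mulInvariantVectorField _) (mdifferentiableAt_mulInvariantVectorField _),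
      neg_add]
  map_smul' c Y := by
    rw [mulInvariantVectorField_smul, mlieBracket_const_smul_right
      (mdifferentiableAt_mulInvariantVectorField _), RingHom.id_apply, smul_neg]

end Flows

/-! Since $\mathfrak g$ is abelian, the left invariant frame commutes, so its dual coframe, the
Maurer-Cartan form, is closed. Simple connectedness gives it a global primitive $F:G\to\mathfrak g$
with $F(1)=0$ (`exists_isDevelopingMap`). This $F$ is a homomorphism, a local homeomorphism and
surjective; injectivity is not needed, since continuous curves in $G$ with the same image and the
same starting point coincide (`curve_eq_of_comp_eq`).

Through $F$ an invariant field becomes a constant vector $v$. A closed orbit of period $T$ forces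
$Tv=0$, so the point is fixed (`not_hasPeriodicOrbit`).

A linear field becomes a linear map $B$ (`exists_developedField_eq`), which is the derivation
because $-[Bx,v]=Bv$ (`fieldDerivation_eq`). Let $q$ be the negative quantity of the hypothesis.
Cayley-Hamilton reads $B^3=qB$, so a nonzero $w=Bu$ satisfies $B^2w=qw$. The plane of $w$ and $Bw$
is filled with elliptic orbits, and a small one lies in the domain of a local inverse of $F$, which
carries it to a periodic orbit (`hasPeriodicOrbit`). -/

open Filter Topology

/-! ### Gluing local primitives on a simply connected space -/

section Gluing

variable {X V : Type*} [TopologicalSpace X] [AddCommGroup V]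

/-- The torsor bundle, with discrete fibre `V`, of the local primitives `f x` on `U x`: its points
over `w` are the values at `w` of a primitive, written in the chart `i` as the difference of that
value and `f i w`. -/
def primitiveBundleCore [TopologicalSpace V] [DiscreteTopology V] (U : X → Set X)
    (hU : ∀ x, IsOpen (U x)) (hxU : ∀ x, x ∈ U x) (f : X → X → V)
    (hf : ∀ x y, ∀ z ∈ U x ∩ U y, ∀ᶠ w in 𝓝 z, f x w - f y w = f x z - f y z) :
    FiberBundleCore X X V where
  baseSet := U
  isOpen_baseSet := hU
  indexAt := id
  mem_baseSet_at := hxU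
  coordChange i j x v := v + (f i x - f j x)
  coordChange_self i x _ v := by simp
  continuousOn_coordChange i j := by
    rintro ⟨z, v⟩ ⟨hz, -⟩
    apply ContinuousAt.continuousWithinAt
    refine continuousAt_snd.add (ContinuousAt.comp (g := fun w ↦ f i w - f j w) (f := Prod.fst)
      ?_ continuousAt_fst)
    exact continuousAt_const.congr ((hf i j z hz).mono fun w hw ↦ hw.symm)
  coordChange_comp i j k x _ v := by abel

/-- On a simply connected space, local functions whose differences are locally constant come from
one global function, up to locally constant functions. -/
theorem exists_global_primitive [SimplyConnectedSpace X] [LocallyPathConnectedSpace X]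
    (U : X → Set X) (hU : ∀ x, IsOpen (U x)) (hxU : ∀ x, x ∈ U x) (f : X → X → V)
    (hf : ∀ x y, ∀ z ∈ U x ∩ U y, ∀ᶠ w in 𝓝 z, f x w - f y w = f x z - f y z) :
    ∃ F : X → V, ∀ x, ∀ᶠ w in 𝓝 x, F w - f x w = F x - f x x := by
  let _ : TopologicalSpace V := ⊥
  have : DiscreteTopology V := ⟨rfl⟩
  let Z := primitiveBundleCore U hU hxU f hf
  have hcov : IsCoveringMap (Bundle.TotalSpace.proj : Bundle.TotalSpace V Z.Fiber → X) :=
    FiberBundle.isCoveringMap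
  obtain ⟨x₀⟩ : Nonempty X := inferInstance
  -- Lifting the identity of a simply connected base through the covering gives a global section.
  obtain ⟨s, ⟨-, hs⟩, -⟩ := hcov.existsUnique_continuousMap_lifts (ContinuousMap.id X) x₀
    (⟨x₀, (0 : V)⟩ : Bundle.TotalSpace V Z.Fiber) rfl
  have hs' : ∀ w, (s w).proj = w := fun w ↦ congrFun hs w
  let F : X → V := fun w ↦ (show V from (s w).2) + f (s w).proj w
  refine ⟨F, fun x ↦ ?_⟩
  have hmem : s x ∈ (Z.localTriv x).source := by
    rw [Z.mem_localTriv_source]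
    change (s x).proj ∈ U x
    rw [hs' x]
    exact hxU x
  have hcont : ContinuousAt (fun w ↦ (Z.localTriv x (s w)).2) x :=
    continuousAt_snd.comp (((Z.localTriv x).continuousAt hmem).comp s.continuous.continuousAt)
  have hval : ∀ w, (Z.localTriv x (s w)).2 = F w - f x w := by
    intro w
    have h2 : (Z.localTriv x (s w)).2
        = (show V from (s w).2) + (f (s w).proj (s w).proj - f x (s w).proj) := rfl
    rw [h2]
    have : ∀ u, u = w → (show V from (s w).2) + (f (s w).proj u - f x u)
        = (show V from (s w).2) + f (s w).proj w - f x w := by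
      rintro u rfl
      abel
    exact this _ (hs' w)
  simp only [hval] at hcont
  -- The fibre is discrete, so continuity means local constancy.
  exact hcont.eventually (show {F x - f x x} ∈ 𝓝 (F x - f x x) from
    (isOpen_discrete _).mem_nhds rfl)

end Gluing

/-! ### Poincaré lemma for the dual of a commuting frame -/

section Frame

variable {E : Type*} [NormedAddCommGroup E] [NormedSpace ℝ E] [FiniteDimensional ℝ E]

/-- The coframe dual to a frame of commuting vector fields on a convex open set is exact. -/
theorem exists_primitive_of_commuting_frame {s : Set E} (hs : Convex ℝ s) (hso : IsOpen s)
    {M : E → E →L[ℝ] E} (hM : ContDiffOn ℝ 1 M s) (hinv : ∀ y ∈ s, (M y).IsInvertible)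
    (hcomm : ∀ a b, ∀ y ∈ s, lieBracket ℝ (fun y ↦ M y a) (fun y ↦ M y b) y = 0) :
    ∃ f : E → E, ContDiffOn ℝ 2 f s ∧ ∀ y ∈ s, HasFDerivAt f (M y).inverse y := by
  have : CompleteSpace E := FiniteDimensional.complete ℝ E
  let θ : E → E →L[ℝ] E := fun y ↦ (M y).inverse
  have hθ : ContDiffOn ℝ 1 θ s := by
    intro y hy
    obtain ⟨e, he⟩ := hinv y hy
    have h := contDiffAt_map_inverse (n := 1) e
    rw [he] at h
    exact h.comp_contDiffWithinAt y (hM y hy)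
  have hθd : DifferentiableOn ℝ θ s := hθ.differentiableOn one_ne_zero
  have hθM : ∀ y ∈ s, ∀ v, θ y (M y v) = v := fun y hy v ↦ by
    obtain ⟨e, he⟩ := hinv y hy
    simp [θ, ← he]
  have hMθ : ∀ y ∈ s, ∀ v, M y (θ y v) = v := fun y hy v ↦ by
    obtain ⟨e, he⟩ := hinv y hy
    simp [θ, ← he]
  -- Differentiating $\theta M b=b$ turns vanishing brackets of the frame into closedness of
  -- $\theta$.
  have hderiv : ∀ y ∈ s, ∀ u b, fderiv ℝ θ y u (M y b) = - θ y (fderiv ℝ (fun z ↦ M z b) y u) := by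
    intro y hy u b
    have hθy : DifferentiableAt ℝ θ y := hθd.differentiableAt (hso.mem_nhds hy)
    have hMy : DifferentiableAt ℝ (fun z ↦ M z b) y :=
      ((hM.differentiableOn one_ne_zero).differentiableAt (hso.mem_nhds hy)).clm_apply
        (differentiableAt_const b)
    have h1 := hθy.hasFDerivAt.clm_apply hMy.hasFDerivAt
    have h2 : HasFDerivAt (fun z ↦ θ z (M z b)) (0 : E →L[ℝ] E) y :=
      (hasFDerivAt_const b y).congr_of_eventuallyEq
        (by filter_upwards [hso.mem_nhds hy] with z hz using hθM z hz b)
    have h3 := congrArg (fun L : E →L[ℝ] E ↦ L u) (h1.unique h2)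
    simp only [add_apply, ContinuousLinearMap.comp_apply,
      ContinuousLinearMap.flip_apply, zero_apply] at h3
    rw [add_comm] at h3
    exact eq_neg_of_add_eq_zero_left h3
  have hsymm : ∀ y ∈ s, ∀ u v, fderiv ℝ θ y u v = fderiv ℝ θ y v u := by
    intro y hy u v
    have h1 := hderiv y hy u (θ y v)
    have h2 := hderiv y hy v (θ y u)
    have h3 := hcomm (θ y u) (θ y v) y hy
    simp only [lieBracket, hMθ y hy] at h1 h2 h3
    rw [h1, h2, sub_eq_zero.1 h3]
  obtain ⟨f, hf⟩ := hs.exists_forall_hasFDerivAt_of_fderiv_symmetric hso hθd hsymm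
  refine ⟨f, ?_, hf⟩
  rw [show (2 : ℕ∞ω) = 1 + 1 by norm_num, contDiffOn_succ_iff_fderiv_of_isOpen hso]
  refine ⟨fun y hy ↦ (hf y hy).differentiableAt.differentiableWithinAt, by simp, ?_⟩
  exact hθ.congr fun y hy ↦ (hf y hy).fderiv

end Frame

/-! ### Local primitives of the Maurer-Cartan form -/

section LieGroup

variable {E : Type*} [NormedAddCommGroup E] [NormedSpace ℝ E]
  {G : Type*} [TopologicalSpace G] [ChartedSpace E G]

/-- A function with vanishing differential is locally constant. -/
theorem eventually_eq_of_mfderiv_eq_zero {F : Type*} [NormedAddCommGroup F] [NormedSpace ℝ F]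
    [IsManifold 𝓘(ℝ, E) 1 G] {f : G → F} {x : G}
    (hf : ∀ᶠ y in 𝓝 x, HasMFDerivAt 𝓘(ℝ, E) 𝓘(ℝ, F) f y (0 : E →L[ℝ] F)) :
    ∀ᶠ y in 𝓝 x, f y = f x := by
  let e := extChartAt 𝓘(ℝ, E) x
  have hx : x ∈ e.source := mem_extChartAt_source x
  have hcont : ContinuousAt e.symm (e x) := continuousAt_extChartAt_symm x
  have hxe : e.symm (e x) = x := e.left_inv hx
  have h1 : ∀ᶠ z in 𝓝 (e x), HasMFDerivAt 𝓘(ℝ, E) 𝓘(ℝ, F) f (e.symm z) (0 : E →L[ℝ] F) :=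
    (show Tendsto e.symm (𝓝 (e x)) (𝓝 x) by simpa only [ContinuousAt, hxe] using hcont).eventually hf
  have h2 : ∀ᶠ z in 𝓝 (e x), z ∈ e.target := extChartAt_target_mem_nhds (I := 𝓘(ℝ, E)) x
  obtain ⟨r, hr, hball⟩ := Metric.eventually_nhds_iff_ball.1 (h1.and h2)
  have hder : ∀ z ∈ Metric.ball (e x) r, HasFDerivAt (f ∘ e.symm) (0 : E →L[ℝ] F) z := by
    intro z hz
    obtain ⟨hz1, hz2⟩ := hball z hz
    have hs : MDifferentiableAt 𝓘(ℝ, E) 𝓘(ℝ, E) e.symm z :=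
      (contMDiffOn_extChartAt_symm (n := 1) x).mdifferentiableOn one_ne_zero |>.mdifferentiableAt
        ((isOpen_extChartAt_target x).mem_nhds hz2)
    have := hz1.comp z hs.hasMFDerivAt
    rw [hasMFDerivAt_iff_hasFDerivAt] at this
    refine this.congr_fderiv ?_
    exact ContinuousLinearMap.zero_comp _
  have hconst : ∀ z ∈ Metric.ball (e x) r, (f ∘ e.symm) z = (f ∘ e.symm) (e x) := by
    intro z hz
    exact (convex_ball (e x) r).is_const_of_fderivWithin_eq_zero (𝕜 := ℝ)
      (fun y hy ↦ (hder y hy).differentiableAt.differentiableWithinAt)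
      (fun y hy ↦ by
        rw [fderivWithin_of_isOpen Metric.isOpen_ball hy, (hder y hy).fderiv])
      hz (Metric.mem_ball_self hr)
  have h3 : ∀ᶠ y in 𝓝 x, e y ∈ Metric.ball (e x) r :=
    (continuousAt_extChartAt (I := 𝓘(ℝ, E)) x).eventually (Metric.ball_mem_nhds _ hr)
  filter_upwards [h3, extChartAt_source_mem_nhds (I := 𝓘(ℝ, E)) x] with y hy hys
  have := hconst (e y) hy
  simp only [Function.comp_apply] at this
  rwa [e.left_inv hys, hxe] at this

variable [Group G] [LieGroup 𝓘(ℝ, E) ∞ G]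

/-- The values at `g` of the left invariant vector fields, as a linear map of the Lie algebra. -/
noncomputable def invariantFrame (g : G) : E →L[ℝ] E :=
  mfderiv 𝓘(ℝ, E) 𝓘(ℝ, E) (g * ·) (1 : G)

theorem isInvertible_mfderiv_mul_left (g h : G) :
    (mfderiv 𝓘(ℝ, E) 𝓘(ℝ, E) (g * ·) h).IsInvertible := by
  have hd : ∀ a b : G, MDifferentiableAt 𝓘(ℝ, E) 𝓘(ℝ, E) (a * ·) b := fun a b ↦
    (contMDiff_mul_left (n := ∞)).contMDiffAt.mdifferentiableAt (by simp)
  have key : ∀ a b c : G, c = a * b → (mfderiv 𝓘(ℝ, E) 𝓘(ℝ, E) (a⁻¹ * ·) c : E →L[ℝ] E) ∘L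
      (mfderiv 𝓘(ℝ, E) 𝓘(ℝ, E) (a * ·) b : E →L[ℝ] E) = ContinuousLinearMap.id ℝ E := by
    rintro a b c rfl
    have h1 := mfderiv_comp b (hd a⁻¹ (a * b)) (hd a b)
    have h2 : (a⁻¹ * ·) ∘ (a * ·) = (id : G → G) := by ext x; simp
    rw [h2, mfderiv_id] at h1
    exact h1.symm
  refine ContinuousLinearMap.IsInvertible.of_inverse
    (g := mfderiv 𝓘(ℝ, E) 𝓘(ℝ, E) (g⁻¹ * ·) (g * h)) ?_ (key g h _ rfl)
  have := key g⁻¹ (g * h) h (by group)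
  rwa [inv_inv] at this

theorem isInvertible_invariantFrame (g : G) : (invariantFrame (E := E) g).IsInvertible :=
  isInvertible_mfderiv_mul_left g 1

variable [FiniteDimensional ℝ E] [CompleteSpace E]

omit [FiniteDimensional ℝ E] [CompleteSpace E] in
theorem mlieBracket_eq_lieBracket (V W : E → E) (x : E) :
    mlieBracket 𝓘(ℝ, E) V W x = lieBracket ℝ V W x :=
  (congrFun (mlieBracketWithin_eq_lieBracketWithin (V := V) (W := W) (s := Set.univ)) x).trans
    (congrFun lieBracketWithin_univ x)

omit [FiniteDimensional ℝ E] in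
theorem mlieBracket_mulInvariantVectorField_eq_zero
    (habelian : IsLieAbelian (GroupLieAlgebra 𝓘(ℝ, E) G)) (v w : GroupLieAlgebra 𝓘(ℝ, E) G) :
    mlieBracket 𝓘(ℝ, E) (mulInvariantVectorField v) (mulInvariantVectorField w)
      = (0 : (g : G) → TangentSpace 𝓘(ℝ, E) g) := by
  rw [← mulInvariantVector_mlieBracket, ← GroupLieAlgebra.bracket_def, habelian.trivial]
  ext g
  exact map_zero (mfderiv 𝓘(ℝ, E) 𝓘(ℝ, E) (g * ·) (1 : G))

/-- Near every point, a Lie group with abelian Lie algebra has a primitive of its Maurer-Cartan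
form. -/
theorem exists_local_primitive (habelian : IsLieAbelian (GroupLieAlgebra 𝓘(ℝ, E) G)) (x : G) :
    ∃ (U : Set G) (f : G → E), IsOpen U ∧ x ∈ U ∧ ∀ g ∈ U, ContMDiffAt 𝓘(ℝ, E) 𝓘(ℝ, E) 2 f g ∧
      HasMFDerivAt 𝓘(ℝ, E) 𝓘(ℝ, E) f g (invariantFrame (E := E) g).inverse := by
  let e := extChartAt 𝓘(ℝ, E) x
  have hcd : ∀ y ∈ e.target, ContMDiffAt 𝓘(ℝ, E) 𝓘(ℝ, E) ∞ e.symm y := fun y hy ↦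
    (contMDiffOn_extChartAt_symm x).contMDiffAt ((isOpen_extChartAt_target x).mem_nhds hy)
  have hinv : ∀ y ∈ e.target, (mfderiv 𝓘(ℝ, E) 𝓘(ℝ, E) e.symm y).IsInvertible := fun y hy ↦ by
    have := isInvertible_mfderivWithin_extChartAt_symm (I := 𝓘(ℝ, E)) hy
    rwa [ModelWithCorners.range_eq_univ, mfderivWithin_univ] at this
  -- The left invariant frame read in the chart; pulling back preserves brackets, so it still
  -- commutes.
  let M : E → E →L[ℝ] E := fun y ↦ (mfderiv 𝓘(ℝ, E) 𝓘(ℝ, E) e.symm y : E →L[ℝ] E).inverse ∘L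
    invariantFrame (e.symm y)
  have hMv : ∀ v : E, (fun y ↦ M y v) = mpullback 𝓘(ℝ, E) 𝓘(ℝ, E) e.symm
      (mulInvariantVectorField (I := 𝓘(ℝ, E)) (G := G) v) := fun v ↦ rfl
  have h2 : minSmoothness ℝ 2 = 2 := minSmoothness_of_isRCLikeNormedField
  have hMsmooth : ContDiffOn ℝ 1 M e.target := by
    rw [contDiffOn_clm_apply]
    intro v y hy
    apply ContDiffAt.contDiffWithinAt
    rw [hMv v, ← contMDiffAt_vectorSpace_iff_contDiffAt]
    refine ContMDiffAt.mpullback_vectorField_preimage (n := 2) ?_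
      ((hcd y hy).of_le ENat.LEInfty.out) (hinv y hy)
      (by norm_num)
    exact (contMDiffAt_mulInvariantVectorField v).of_le (by rw [h2]; norm_num)
  have hMinv : ∀ y ∈ e.target, (M y).IsInvertible := fun y hy ↦
    (ContinuousLinearMap.IsInvertible.inverse (hinv y hy)).comp (isInvertible_invariantFrame _)
  have hcomm : ∀ a b, ∀ y ∈ e.target, lieBracket ℝ (fun y ↦ M y a) (fun y ↦ M y b) y = 0 := by
    intro a b y hy
    have h := mpullback_mlieBracket (I := 𝓘(ℝ, E)) (I' := 𝓘(ℝ, E)) (f := e.symm) (x₀ := y)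
      (V := mulInvariantVectorField (I := 𝓘(ℝ, E)) (G := G) a)
      (W := mulInvariantVectorField (I := 𝓘(ℝ, E)) (G := G) b)
      (mdifferentiableAt_mulInvariantVectorField _) (mdifferentiableAt_mulInvariantVectorField _)
      (hcd y hy) (by rw [h2]; exact ENat.LEInfty.out)
    have h0 := congrFun (mlieBracket_mulInvariantVectorField_eq_zero habelian a b) (e.symm y)
    exact (mlieBracket_eq_lieBracket (fun y ↦ M y a) (fun y ↦ M y b) y).symm.trans
      (h.symm.trans ((congrArg (mfderiv 𝓘(ℝ, E) 𝓘(ℝ, E) e.symm y).inverse h0).trans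
        (map_zero (mfderiv 𝓘(ℝ, E) 𝓘(ℝ, E) e.symm y).inverse)))
  obtain ⟨r, hr, hball⟩ := Metric.nhds_basis_ball.mem_iff.1
    (extChartAt_target_mem_nhds (I := 𝓘(ℝ, E)) x)
  obtain ⟨f, hf, hf'⟩ := exists_primitive_of_commuting_frame (convex_ball (e x) r)
    Metric.isOpen_ball (hMsmooth.mono hball) (fun y hy ↦ hMinv y (hball hy))
    (fun a b y hy ↦ hcomm a b y (hball hy))
  refine ⟨e.source ∩ e ⁻¹' Metric.ball (e x) r, f ∘ e,
    (continuousOn_extChartAt x).isOpen_inter_preimage (isOpen_extChartAt_source x)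
      Metric.isOpen_ball, ⟨mem_extChartAt_source x, Metric.mem_ball_self hr⟩, ?_⟩
  rintro g ⟨hg, hgr⟩
  have hesmooth : ContMDiffAt 𝓘(ℝ, E) 𝓘(ℝ, E) 2 e g :=
    contMDiffAt_extChartAt' (by rwa [extChartAt_source] at hg)
  refine ⟨((hf.contDiffAt (Metric.isOpen_ball.mem_nhds hgr)).contMDiffAt).comp g hesmooth, ?_⟩
  have h3 := (hf' (e g) hgr).hasMFDerivAt.comp g
    (hesmooth.mdifferentiableAt (by simp)).hasMFDerivAt
  refine h3.congr_mfderiv ?_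
  have hge : e.symm (e g) = g := e.left_inv hg
  have hinvg : (mfderiv 𝓘(ℝ, E) 𝓘(ℝ, E) e g : E →L[ℝ] E)
      = (mfderiv 𝓘(ℝ, E) 𝓘(ℝ, E) e.symm (e g) : E →L[ℝ] E).inverse := by
    refine (ContinuousLinearMap.inverse_eq ?_ ?_).symm
    · have := mfderivWithin_extChartAt_symm_comp_mfderiv_extChartAt' (I := 𝓘(ℝ, E)) hg
      rwa [ModelWithCorners.range_eq_univ, mfderivWithin_univ] at this
    · have := mfderiv_extChartAt_comp_mfderivWithin_extChartAt_symm' (I := 𝓘(ℝ, E)) hg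
      rwa [ModelWithCorners.range_eq_univ, mfderivWithin_univ] at this
  refine ContinuousLinearMap.ext fun (v : E) ↦ ?_
  obtain ⟨u, rfl⟩ := (isInvertible_invariantFrame (E := E) g).surjective v
  have h4 : (mfderiv 𝓘(ℝ, E) 𝓘(ℝ, E) e g : E →L[ℝ] E) (invariantFrame (E := E) g u) = M (e g) u := by
    rw [hinvg]
    simp only [M, hge]
    rfl
  have h5 := (isInvertible_invariantFrame (E := E) g).inverse_apply_self u
  have h6 := (hMinv _ (hball hgr)).inverse_apply_self u
  rw [← h4] at h6
  exact h6.trans h5.symm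

end LieGroup

/-! ### The developing map and its properties -/

section DevelopingMap

variable {E : Type*} [NormedAddCommGroup E] [NormedSpace ℝ E]
  {E' : Type*} [NormedAddCommGroup E'] [NormedSpace ℝ E']
  {G : Type*} [TopologicalSpace G] [ChartedSpace E G] [Group G] [LieGroup 𝓘(ℝ, E) ∞ G]

theorem inverse_invariantFrame (g : G) :
    (invariantFrame (E := E) g).inverse = mfderiv 𝓘(ℝ, E) 𝓘(ℝ, E) (g⁻¹ * ·) g := by
  have h := inverse_mfderiv_mul_left (I := 𝓘(ℝ, E)) (g := g) (h := 1)
  have key : ∀ c : G, c = g → (mfderiv 𝓘(ℝ, E) 𝓘(ℝ, E) (g⁻¹ * ·) c : E →L[ℝ] E)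
      = (mfderiv 𝓘(ℝ, E) 𝓘(ℝ, E) (g⁻¹ * ·) g : E →L[ℝ] E) := by
    rintro c rfl
    rfl
  exact Eq.trans h (key _ (mul_one g))

theorem mdifferentiableAt_mul_left' (g h : G) : MDifferentiableAt 𝓘(ℝ, E) 𝓘(ℝ, E) (g * ·) h :=
  (contMDiff_mul_left (n := ∞)).contMDiffAt.mdifferentiableAt (by simp)

theorem mdifferentiableAt_mul_right' (g h : G) : MDifferentiableAt 𝓘(ℝ, E) 𝓘(ℝ, E) (· * g) h :=
  (contMDiff_mul_right (n := ∞)).contMDiffAt.mdifferentiableAt (by simp)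

/-- Left invariance of the Maurer-Cartan form, from $(gh)^{-1}g=h^{-1}$. -/
theorem inverse_invariantFrame_comp_mfderiv_mul_left (g h : G) :
    (invariantFrame (E := E) (g * h)).inverse ∘L
      (mfderiv 𝓘(ℝ, E) 𝓘(ℝ, E) (g * ·) h : E →L[ℝ] E) = (invariantFrame (E := E) h).inverse := by
  rw [inverse_invariantFrame, inverse_invariantFrame]
  have h1 := mfderiv_comp (I := 𝓘(ℝ, E)) h (mdifferentiableAt_mul_left' (E := E) (g * h)⁻¹ (g * h))
    (mdifferentiableAt_mul_left' (E := E) g h)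
  rw [show ((g * h)⁻¹ * ·) ∘ (g * ·) = (h⁻¹ * · : G → G) by ext x; simp [mul_assoc]] at h1
  exact h1.symm

/-- Two functions on a connected manifold with the same differential agree if they agree at one
point. -/
theorem eq_of_hasMFDerivAt_eq [PreconnectedSpace G] {f₁ f₂ : G → E'} {L : G → E →L[ℝ] E'}
    (h₁ : ∀ g, HasMFDerivAt 𝓘(ℝ, E) 𝓘(ℝ, E') f₁ g (L g))
    (h₂ : ∀ g, HasMFDerivAt 𝓘(ℝ, E) 𝓘(ℝ, E') f₂ g (L g)) {x : G} (hx : f₁ x = f₂ x) :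
    f₁ = f₂ := by
  have hloc : IsLocallyConstant (f₁ - f₂) := by
    rw [IsLocallyConstant.iff_eventually_eq]
    intro y
    refine eventually_eq_of_mfderiv_eq_zero (E := E) (Eventually.of_forall fun z ↦ ?_)
    exact ((h₁ z).sub (h₂ z)).congr_mfderiv (sub_self (L z))
  ext y
  have := hloc.apply_eq_of_preconnectedSpace y x
  simp only [Pi.sub_apply, hx, sub_self] at this
  exact sub_eq_zero.1 this

/-- A primitive of the Maurer-Cartan form of `G`, normalised to vanish at the identity. -/
structure IsDevelopingMap (F : G → E) : Prop where
  map_one : F 1 = 0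
  contMDiff : ContMDiff 𝓘(ℝ, E) 𝓘(ℝ, E) 2 F
  hasMFDerivAt : ∀ g, HasMFDerivAt 𝓘(ℝ, E) 𝓘(ℝ, E) F g (invariantFrame (E := E) g).inverse

/-- Two local primitives differ by a function with zero differential, hence locally constant, so
they glue. -/
theorem exists_isDevelopingMap [FiniteDimensional ℝ E] [CompleteSpace E] [SimplyConnectedSpace G]
    (habelian : IsLieAbelian (GroupLieAlgebra 𝓘(ℝ, E) G)) :
    ∃ F : G → E, IsDevelopingMap F := by
  have : LocallyPathConnectedSpace G := ChartedSpace.locallyPathConnectedSpace E G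
  choose U f hU hxU hf using fun x : G ↦ exists_local_primitive habelian x
  obtain ⟨F, hF⟩ := exists_global_primitive U hU hxU f (by
    intro x y z hz
    refine eventually_eq_of_mfderiv_eq_zero (E := E) (f := f x - f y) ?_
    filter_upwards [((hU x).inter (hU y)).mem_nhds hz] with w hw
    exact ((hf x w hw.1).2.sub (hf y w hw.2).2).congr_mfderiv (sub_self _))
  have hF' : ∀ x, (fun w ↦ F w - F 1) =ᶠ[𝓝 x] fun w ↦ f x w + (F x - f x x - F 1) := by
    intro x
    filter_upwards [hF x] with w hw
    rw [← hw]
    abel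
  refine ⟨fun w ↦ F w - F 1, sub_self _, fun x ↦ ?_, fun x ↦ ?_⟩
  · exact ((hf x x (hxU x)).1.add contMDiffAt_const).congr_of_eventuallyEq (hF' x)
  · refine HasMFDerivAt.congr_of_eventuallyEq ?_ (hF' x)
    exact ((hf x x (hxU x)).2.add (hasMFDerivAt_const _ x)).congr_mfderiv (add_zero _)

namespace IsDevelopingMap

variable {F : G → E} (hF : IsDevelopingMap F)

include hF

/-- By left invariance $h\mapsto F(gh)-F(g)$ is again a primitive vanishing at $1$. -/
theorem map_mul [PreconnectedSpace G] (g h : G) : F (g * h) = F g + F h := by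
  have key : (fun h ↦ F (g * h) + -F g) = F := by
    refine eq_of_hasMFDerivAt_eq (E := E) (x := (1 : G)) (fun h ↦ ?_) hF.hasMFDerivAt ?_
    · have h1 := (hF.hasMFDerivAt (g * h)).comp h
        (mdifferentiableAt_mul_left' (E := E) g h).hasMFDerivAt
      have h2 := h1.congr_mfderiv
        (inverse_invariantFrame_comp_mfderiv_mul_left (E := E) g h)
      exact (h2.add (hasMFDerivAt_const (-F g) h)).congr_mfderiv (add_zero _)
    · simp [hF.map_one]
  have := congrFun key h
  rw [← this]
  exact (add_neg_cancel_comm_assoc (F g) _).symm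

theorem map_pow [PreconnectedSpace G] (g : G) (n : ℕ) : F (g ^ n) = n • F g := by
  induction n with
  | zero => simp [hF.map_one]
  | succ n ih => rw [pow_succ, hF.map_mul, ih, succ_nsmul]

/-- Every homomorphism to a vector space factors linearly through the developing map. -/
theorem exists_factor [PreconnectedSpace G] {K : G → E'}
    (hK : MDifferentiableAt 𝓘(ℝ, E) 𝓘(ℝ, E') K 1) (hmul : ∀ g h, K (g * h) = K g + K h) :
    ∃ A : E →L[ℝ] E', ∀ g, K g = A (F g) := by
  have hK1 : K 1 = 0 := by simpa using hmul 1 1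
  let A : E →L[ℝ] E' := mfderiv 𝓘(ℝ, E) 𝓘(ℝ, E') K 1
  have hA : HasMFDerivAt 𝓘(ℝ, E) 𝓘(ℝ, E') K 1 A := hK.hasMFDerivAt
  refine ⟨A, congrFun (f := K) (g := fun g ↦ A (F g)) ?_⟩
  refine eq_of_hasMFDerivAt_eq (E := E) (x := (1 : G))
    (L := fun g ↦ A ∘L (invariantFrame (E := E) g).inverse) (fun g ↦ ?_) (fun g ↦ ?_) ?_
  · have h0 : ∀ c : G, c = 1 → HasMFDerivAt 𝓘(ℝ, E) 𝓘(ℝ, E') K c A := by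
      rintro c rfl
      exact hA
    have h1 := (h0 (g⁻¹ * g) (by group)).comp g
      (mdifferentiableAt_mul_left' (E := E) g⁻¹ g).hasMFDerivAt
    have h2 := (h1.add (hasMFDerivAt_const (K g) g)).congr_mfderiv (add_zero _)
    -- Additivity transports the differential at $1$ to every $g$.
    have h3 : K = K ∘ (g⁻¹ * ·) + fun _ ↦ K g := by
      ext h
      rw [Pi.add_apply, Function.comp_apply, add_comm, ← hmul, mul_inv_cancel_left]
    rw [inverse_invariantFrame, h3]
    exact h2
  · exact A.hasMFDerivAt.comp g (hF.hasMFDerivAt g)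
  · simp [hK1, hF.map_one]

/-- The inverse function theorem in a chart: the differential of $F$ is an inverse frame, hence
invertible. -/
theorem isLocalHomeomorph [CompleteSpace E] : IsLocalHomeomorph F := by
  refine IsLocalHomeomorph.mk F fun x ↦ ?_
  let e := chartAt E x
  have hx : x ∈ e.source := mem_chart_source E x
  have hsymm : ContMDiffAt 𝓘(ℝ, E) 𝓘(ℝ, E) 2 e.symm (e x) :=
    (contMDiffOn_chart_symm (I := 𝓘(ℝ, E)) (x := x)).contMDiffAt
      (e.open_target.mem_nhds (e.map_source hx))
  have hc : ContDiffAt ℝ 2 (F ∘ e.symm) (e x) :=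
    contMDiffAt_iff_contDiffAt.1 (hF.contMDiff.contMDiffAt.comp (e x) hsymm)
  have hinv : (fderiv ℝ (F ∘ e.symm) (e x)).IsInvertible := by
    have h1 := isInvertible_mfderivWithin_extChartAt_symm (I := 𝓘(ℝ, E)) (mem_extChartAt_target x)
    rw [ModelWithCorners.range_eq_univ, mfderivWithin_univ] at h1
    have h2 : ∀ y : G, (invariantFrame (E := E) y).inverse.IsInvertible := fun y ↦
      (isInvertible_invariantFrame y).inverse
    have h3 := (hF.hasMFDerivAt (e.symm (e x))).comp (e x)
      (hsymm.mdifferentiableAt (by simp)).hasMFDerivAt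
    have h4 : ((invariantFrame (E := E) (e.symm (e x))).inverse ∘L
        (mfderiv 𝓘(ℝ, E) 𝓘(ℝ, E) e.symm (e x) : E →L[ℝ] E)).IsInvertible := (h2 _).comp h1
    have h5 : HasFDerivAt (F ∘ e.symm) ((invariantFrame (E := E) (e.symm (e x))).inverse ∘L
        (mfderiv 𝓘(ℝ, E) 𝓘(ℝ, E) e.symm (e x) : E →L[ℝ] E)) (e x) :=
      hasMFDerivAt_iff_hasFDerivAt.1 h3
    rw [h5.fderiv]
    exact h4
  obtain ⟨L, hL⟩ := hinv
  have hs : HasStrictFDerivAt (F ∘ e.symm) (L : E →L[ℝ] E) (e x) := by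
    rw [hL]
    exact hc.hasStrictFDerivAt (by simp)
  let Φ := hs.toOpenPartialHomeomorph (F ∘ e.symm)
  refine ⟨e.trans Φ, ⟨hx, hs.mem_toOpenPartialHomeomorph_source⟩, fun y hy ↦ ?_⟩
  change F y = F (e.symm (e y))
  rw [e.left_inv hy.1]

/-- The image is a neighbourhood of $0$, so it contains $v/(n+1)$ for some $n$, and powers in $G$
become multiples. -/
theorem surjective [CompleteSpace E] [PreconnectedSpace G] : Function.Surjective F := by
  intro v
  have hr : Set.range F ∈ 𝓝 (0 : E) :=
    hF.isLocalHomeomorph.isOpenMap.isOpen_range.mem_nhds ⟨1, hF.map_one⟩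
  have ht : Tendsto (fun n : ℕ ↦ ((n : ℝ) + 1)⁻¹ • v) atTop (𝓝 0) := by
    simpa using (tendsto_one_div_add_atTop_nhds_zero_nat (𝕜 := ℝ)).smul_const v
  obtain ⟨n, g, hg⟩ := (ht.eventually hr).exists
  refine ⟨g ^ (n + 1), ?_⟩
  rw [hF.map_pow, hg, ← Nat.cast_smul_eq_nsmul ℝ, smul_smul]
  have : (n : ℝ) + 1 ≠ 0 := by positivity
  simp [this]

end IsDevelopingMap

end DevelopingMap

/-! ### Flows and invariant fields in the developing map -/

section Flow

variable {E : Type*} [NormedAddCommGroup E] [NormedSpace ℝ E] [CompleteSpace E]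
  {G : Type*} [TopologicalSpace G] [T2Space G] [ChartedSpace E G] [Group G]
  [LieGroup 𝓘(ℝ, E) ∞ G] {F : G → E}
  {X : (g : G) → TangentSpace 𝓘(ℝ, E) g} {φ : ℝ → G → G}

omit [CompleteSpace E] [T2Space G] in
theorem IsFlowOf.continuous_orbit (hφ : IsFlowOf X φ) (g : G) : Continuous (fun t ↦ φ t g) :=
  hφ.contMDiff_flow.continuous.comp (Continuous.prodMk_left g)

/-- A vector field in the trivialisation of the tangent bundle given by a developing map. -/
noncomputable def developedField (X : (g : G) → TangentSpace 𝓘(ℝ, E) g) (g : G) : E :=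
  (invariantFrame (E := E) g).inverse (X g)

namespace IsDevelopingMap

omit [CompleteSpace E] [T2Space G] in
theorem hasDerivAt_orbit (hF : IsDevelopingMap F) (hφ : IsFlowOf X φ) (g : G) (t : ℝ) :
    HasDerivAt (fun t ↦ F (φ t g)) (developedField X (φ t g)) t := by
  have h := (hF.hasMFDerivAt (φ t g)).comp t (hφ.isMIntegralCurve g t)
  have h' : HasFDerivAt (fun t ↦ F (φ t g)) ((invariantFrame (E := E) (φ t g)).inverse ∘L
      ((1 : ℝ →L[ℝ] ℝ).smulRight (X (φ t g)) : ℝ →L[ℝ] E)) t := hasMFDerivAt_iff_hasFDerivAt.1 h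
  refine h'.hasDerivAt.congr_deriv ?_
  change (invariantFrame (E := E) (φ t g)).inverse ((1 : ℝ) • X (φ t g)) = _
  rw [one_smul]
  rfl

/-- Unique lifting needs only a Hausdorff source and local injectivity of $F$. -/
theorem curve_eq_of_comp_eq (hF : IsDevelopingMap F) {γ₁ γ₂ : ℝ → G} (h₁ : Continuous γ₁)
    (h₂ : Continuous γ₂) (h : ∀ t, F (γ₁ t) = F (γ₂ t)) (h0 : γ₁ 0 = γ₂ 0) : γ₁ = γ₂ :=
  (T2Space.isSeparatedMap F).eq_of_comp_eq hF.isLocalHomeomorph.isLocallyInjective h₁ h₂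
    (funext h) 0 h0

/-- A flow that is a translation in the developing map has no periodic orbit. -/
theorem not_hasPeriodicOrbit (hF : IsDevelopingMap F) (hφ : IsFlowOf X φ) {v : E}
    (hX : ∀ g, developedField X g = v) : ¬ HasPeriodicOrbit φ := by
  rintro ⟨g, ⟨T, hT, hper⟩, hfix⟩
  have hder : ∀ t, HasDerivAt (fun t ↦ F (φ t g) - t • v) 0 t := fun t ↦ by
    have h1 := (hF.hasDerivAt_orbit hφ g t).sub ((hasDerivAt_id t).smul_const v)
    simp only [hX, one_smul, sub_self] at h1
    exact h1
  have hconst : ∀ t, F (φ t g) - t • v = F g := fun t ↦ by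
    have := is_const_of_deriv_eq_zero (fun t ↦ (hder t).differentiableAt)
      (fun t ↦ (hder t).deriv) t 0
    simpa [hφ.map_zero] using this
  have hv : v = 0 := by
    have h1 := hconst T
    have h2 := hper 0
    rw [zero_add] at h2
    rw [h2, hφ.map_zero, sub_eq_self, smul_eq_zero] at h1
    exact h1.resolve_left hT.ne'
  refine hfix fun t ↦ congrFun (hF.curve_eq_of_comp_eq (hφ.continuous_orbit g)
    (continuous_const (y := g)) (fun t ↦ ?_) (hφ.map_zero g)) t
  simpa [hv] using hconst t

end IsDevelopingMap

omit [CompleteSpace E] [T2Space G] in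
theorem IsLeftInvariant.developedField_eq (hX : IsLeftInvariant X) (g : G) :
    developedField X g = developedField X 1 := by
  have key : developedField X (g * 1) = developedField X 1 := by
    have h := congrArg (fun L : E →L[ℝ] E ↦ L (X 1))
      (inverse_invariantFrame_comp_mfderiv_mul_left (E := E) g 1)
    rw [developedField, hX g 1]
    exact h
  rwa [mul_one] at key

-- $F(hg)=F(h)+F(g)$ makes $dF$ right invariant as well.
omit [CompleteSpace E] [T2Space G] in
theorem IsRightInvariant.developedField_eq [PreconnectedSpace G] (hF : IsDevelopingMap F)
    (hX : IsRightInvariant X) (g : G) : developedField X g = developedField X 1 := by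
  have key : developedField X (1 * g) = developedField X 1 := by
    have h1 := (hF.hasMFDerivAt (1 * g)).comp 1
      (mdifferentiableAt_mul_right' (E := E) g 1).hasMFDerivAt
    have h2 := ((hF.hasMFDerivAt 1).add (hasMFDerivAt_const (F g) (1 : G))).congr_mfderiv
      (add_zero _)
    have h3 : F ∘ (· * g) = F + fun _ ↦ F g := funext fun h ↦ hF.map_mul h g
    rw [h3] at h1
    have h := congrArg (fun L : E →L[ℝ] E ↦ L (X 1)) (hasMFDerivAt_unique h1 h2)
    rw [developedField, hX 1 g]
    exact h
  rwa [one_mul] at key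

end Flow

/-! ### Linear flows, their derivations and periodic orbits -/

section LinearFlow

variable {E : Type*} [NormedAddCommGroup E] [NormedSpace ℝ E] [CompleteSpace E]
  {G : Type*} [TopologicalSpace G] [ChartedSpace E G] [Group G]
  [LieGroup 𝓘(ℝ, E) ∞ G] {F : G → E}
  {X : (g : G) → TangentSpace 𝓘(ℝ, E) g} {φ : ℝ → G → G}

namespace IsDevelopingMap

omit [CompleteSpace E] in
theorem exists_linear_flow [PreconnectedSpace G] (hF : IsDevelopingMap F)
    (hφ : IsLinearFlow X φ) : ∃ A : ℝ → E →L[ℝ] E, ∀ t g, F (φ t g) = A t (F g) := by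
  have h : ∀ t, ∃ A : E →L[ℝ] E, ∀ g, F (φ t g) = A (F g) := fun t ↦ by
    obtain ⟨Φ, hΦ, -, hΦφ⟩ := hφ.automorphism t
    refine hF.exists_factor (K := fun g ↦ F (φ t g)) ?_ fun g h ↦ ?_
    · simp only [← hΦφ]
      exact ((hF.contMDiff.mdifferentiable (by simp)) _).comp 1
        ((hΦ.mdifferentiable (by simp)) 1)
    · rw [← hΦφ, ← hΦφ, ← hΦφ, Φ.map_mul, hF.map_mul]
  choose A hA using h
  exact ⟨A, hA⟩

/-- In the developing map, a linear vector field is linear. -/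
theorem exists_developedField_eq [PreconnectedSpace G] [FiniteDimensional ℝ E]
    (hF : IsDevelopingMap F) (hφ : IsLinearFlow X φ) :
    ∃ B : E →L[ℝ] E, ∀ g, developedField X g = B (F g) := by
  obtain ⟨A, hA⟩ := hF.exists_linear_flow hφ
  have hder : ∀ g, HasDerivAt (fun t ↦ A t (F g)) (developedField X g) 0 := fun g ↦ by
    have h := hF.hasDerivAt_orbit hφ.toIsFlowOf g 0
    simp only [hA, hφ.map_zero] at h
    exact h
  -- No regularity of $t\mapsto A_t$ is given beforehand; surjectivity of $F$ supplies it from the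
  -- orbits.
  have hdiff : ∀ v, DifferentiableAt ℝ (fun t ↦ A t v) 0 := fun v ↦ by
    obtain ⟨g, rfl⟩ := hF.surjective v
    exact (hder g).differentiableAt
  let B : E →ₗ[ℝ] E :=
    { toFun := fun v ↦ deriv (fun t ↦ A t v) 0
      map_add' := fun v w ↦ by
        simp only [map_add]
        exact deriv_add (hdiff v) (hdiff w)
      map_smul' := fun c v ↦ by
        simp only [map_smul, RingHom.id_apply]
        exact deriv_const_smul c (hdiff v) }
  exact ⟨LinearMap.toContinuousLinearMap B, fun g ↦ (hder g).deriv.symm⟩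

/-- The derivation of a vector field that is linear in the developing map. -/
theorem fieldDerivation_eq (hF : IsDevelopingMap F) {B : E →L[ℝ] E}
    (hB : ∀ g, developedField X g = B (F g)) (v : E) : fieldDerivation X v = B v := by
  have hdF : ∀ g, (mfderiv 𝓘(ℝ, E) 𝓘(ℝ, E) F g : E →L[ℝ] E).inverse
      = invariantFrame (E := E) g := fun g ↦
    (congrArg ContinuousLinearMap.inverse (hF.hasMFDerivAt g).mfderiv).trans
      (isInvertible_invariantFrame (E := E) g).inverse_inverse
  -- Both fields are pullbacks along $F$, of $x\mapsto Bx$ and of the constant $v$, so the bracket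
  -- is computed in $E$.
  have hXF : X = mpullback 𝓘(ℝ, E) 𝓘(ℝ, E) F (fun x ↦ B x) := by
    funext g
    refine Eq.trans ?_ (congrArg (fun L : E →L[ℝ] E ↦ L (B (F g))) (hdF g)).symm
    rw [← hB g]
    exact ((isInvertible_invariantFrame (E := E) g).self_apply_inverse (X g)).symm
  have hYF : mulInvariantVectorField (I := 𝓘(ℝ, E)) (G := G) v
      = mpullback 𝓘(ℝ, E) 𝓘(ℝ, E) F (fun _ ↦ v) := by
    funext g
    exact (congrArg (fun L : E →L[ℝ] E ↦ L v) (hdF g)).symm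
  have hV : MDifferentiableAt 𝓘(ℝ, E) 𝓘(ℝ, E).tangent
      (fun x : E ↦ (⟨x, B x⟩ : TangentBundle 𝓘(ℝ, E) E)) (F 1) :=
    (contMDiffAt_vectorSpace_iff_contDiffAt.2 B.contDiff.contDiffAt).mdifferentiableAt one_ne_zero
  have hW : MDifferentiableAt 𝓘(ℝ, E) 𝓘(ℝ, E).tangent
      (fun x : E ↦ (⟨x, v⟩ : TangentBundle 𝓘(ℝ, E) E)) (F 1) :=
    (contMDiffAt_vectorSpace_iff_contDiffAt.2 contDiffAt_const).mdifferentiableAt one_ne_zero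
  have h := mpullback_mlieBracket hV hW hF.contMDiff.contMDiffAt
    minSmoothness_of_isRCLikeNormedField.le
  rw [← hXF, ← hYF] at h
  have hone : invariantFrame (E := E) (1 : G) = ContinuousLinearMap.id ℝ E := by
    have : ((1 : G) * ·) = id := funext one_mul
    rw [invariantFrame, this]
    exact mfderiv_id
  have hbr : lieBracket ℝ (fun x ↦ B x) (fun _ ↦ v) (F 1) = - B v := by
    simp [lieBracket]
  change -mlieBracket 𝓘(ℝ, E) X (mulInvariantVectorField v) (1 : G) = B v
  rw [← h, mpullback_apply]
  have h1 := congrArg (fun L : E →L[ℝ] E ↦ L (mlieBracket 𝓘(ℝ, E) (fun x : E ↦ (B x : E))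
    (fun _ : E ↦ v) (F 1))) ((hdF 1).trans hone)
  have h2 := (mlieBracket_eq_lieBracket (fun x ↦ B x) (fun _ ↦ v) (F 1)).trans hbr
  exact (congrArg (fun x : E ↦ -x) (h1.trans h2)).trans (neg_neg (B v))

/-- If the linearised field `B` satisfies `B² w = -c w` with `w ≠ 0` and `c > 0`, a small ellipse in
the plane of `w` and `B w` lifts to a periodic orbit. -/
theorem hasPeriodicOrbit [T2Space G] (hF : IsDevelopingMap F) (hφ : IsFlowOf X φ) {B : E →L[ℝ] E}
    (hB : ∀ g, developedField X g = B (F g)) {w : E} (hw : w ≠ 0) {c : ℝ} (hc : 0 < c)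
    (hBw : B (B w) = -c • w) : HasPeriodicOrbit φ := by
  obtain ⟨Φ, h1, rfl⟩ := hF.isLocalHomeomorph 1
  have h0 : (0 : E) ∈ Φ.target := by
    rw [← hF.map_one]
    exact Φ.map_source h1
  obtain ⟨r, hr, hball⟩ := Metric.mem_nhds_iff.1 (Φ.open_target.mem_nhds h0)
  have hs : √c ≠ 0 := (Real.sqrt_pos.2 hc).ne'
  let C : ℝ := ‖w‖ + ‖(√c)⁻¹ • B w‖
  have hC : 0 ≤ C := by positivity
  -- $C$ bounds the unscaled ellipse; this scaling puts it strictly inside the ball of radius $r$.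
  let ε : ℝ := r / (C + 1)
  have hε : 0 < ε := by positivity
  let γ : ℝ → E := fun t ↦ ε • (Real.cos (√c * t) • w + Real.sin (√c * t) • (√c)⁻¹ • B w)
  have hγball : ∀ t, γ t ∈ Φ.target := fun t ↦ by
    refine hball ?_
    rw [mem_ball_zero_iff]
    have hle : ‖Real.cos (√c * t) • w + Real.sin (√c * t) • (√c)⁻¹ • B w‖ ≤ C := by
      refine (norm_add_le _ _).trans (add_le_add ?_ ?_)
      · rw [norm_smul]
        exact mul_le_of_le_one_left (norm_nonneg _) (Real.abs_cos_le_one _)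
      · rw [norm_smul]
        exact mul_le_of_le_one_left (norm_nonneg _) (Real.abs_sin_le_one _)
    calc ‖γ t‖ = ε * ‖Real.cos (√c * t) • w + Real.sin (√c * t) • (√c)⁻¹ • B w‖ := by
          rw [norm_smul, Real.norm_of_nonneg hε.le]
      _ ≤ ε * C := by gcongr
      _ < ε * (C + 1) := by gcongr; linarith
      _ = r := div_mul_cancel₀ r (by positivity)
  have hγder : ∀ t, HasDerivAt γ (B (γ t)) t := fun t ↦ by
    have hlin : HasDerivAt (fun t : ℝ ↦ √c * t) √c t := by
      simpa using (hasDerivAt_id t).const_mul √c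
    have h := ((hlin.cos.smul_const w).add (hlin.sin.smul_const ((√c)⁻¹ • B w))).const_smul ε
    refine h.congr_deriv ?_
    simp only [γ, map_smul, map_add, hBw, smul_smul]
    rw [add_comm]
    congr 2
    · congr 1
      field_simp
    · congr 1
      field_simp
      rw [Real.sq_sqrt hc.le]
      ring
  let g : G := Φ.symm (γ 0)
  have hγcont : Continuous γ := continuous_iff_continuousAt.2 fun t ↦ (hγder t).continuousAt
  have hlift : ∀ t, Φ (φ t g) = γ t := by
    have huniq := ODE_solution_unique_univ (v := fun _ x ↦ B x) (s := fun _ ↦ Set.univ)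
      (K := ‖B‖₊) (f := fun t ↦ Φ (φ t g)) (g := γ) (t₀ := 0)
      (fun t ↦ B.lipschitz.lipschitzOnWith) (fun t ↦ ⟨?_, trivial⟩)
      (fun t ↦ ⟨hγder t, trivial⟩) ?_
    · exact congrFun huniq
    · have := hF.hasDerivAt_orbit hφ g t
      rwa [hB] at this
    · simp only [hφ.map_zero, g]
      exact Φ.right_inv (hγball 0)
  -- The orbit might leave the source of $\Phi$; unique lifting shows that it is the lifted ellipse.
  have horb : (fun t ↦ φ t g) = fun t ↦ Φ.symm (γ t) := by
    refine hF.curve_eq_of_comp_eq (hφ.continuous_orbit g)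
      (Φ.continuousOn_symm.comp_continuous hγcont hγball) (fun t ↦ ?_) (hφ.map_zero g)
    rw [hlift, Φ.right_inv (hγball t)]
  refine ⟨g, ⟨2 * Real.pi / √c, by positivity, fun t ↦ ?_⟩, fun hfix ↦ ?_⟩
  · have hper : γ (t + 2 * Real.pi / √c) = γ t := by
      have : √c * (t + 2 * Real.pi / √c) = √c * t + 2 * Real.pi := by field_simp
      simp only [γ, this, Real.cos_add_two_pi, Real.sin_add_two_pi]
    have h2 := congrFun horb (t + 2 * Real.pi / √c)
    have h3 := congrFun horb t
    exact h2.trans ((congrArg Φ.symm hper).trans h3.symm)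
  -- After half a period $\gamma$ is at $-\gamma(0)\ne\gamma(0)$.
  · have hπ := hlift (Real.pi / √c)
    rw [hfix, ← hfix 0, hlift 0] at hπ
    have : √c * (Real.pi / √c) = Real.pi := by field_simp
    simp only [γ, this, mul_zero, Real.cos_zero, Real.sin_zero, Real.cos_pi, Real.sin_pi, one_smul,
      zero_smul, add_zero, neg_smul, smul_neg] at hπ
    have h2 := add_eq_zero_iff_eq_neg.2 hπ
    rw [← two_smul ℝ] at h2
    exact smul_ne_zero two_ne_zero (smul_ne_zero hε.ne' hw) h2

end IsDevelopingMap

end LinearFlow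

/-! ### Linear algebra of the derivation, and the conclusion -/

/-- Cayley-Hamilton for a `3 × 3` matrix with vanishing trace and determinant. -/
theorem Matrix.mul_mul_self_eq_of_trace_eq_zero_of_det_eq_zero {x₁ x₂ x₃ y₁ y₂ y₃ z₁ z₂ z₃ : ℝ}
    {M : Matrix (Fin 3) (Fin 3) ℝ} (hM : M = !![x₁, x₂, x₃; y₁, y₂, y₃; z₁, z₂, z₃])
    (htr : M.trace = 0) (hdet : M.det = 0) :
    M * (M * M) = (x₂ * y₁ - x₁ * y₂ + x₃ * z₁ - x₁ * z₃ + y₃ * z₂ - y₂ * z₃) • M := by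
  have key : M * (M * M) = M.trace • (M * M)
      + (x₂ * y₁ - x₁ * y₂ + x₃ * z₁ - x₁ * z₃ + y₃ * z₂ - y₂ * z₃) • M + M.det • 1 := by
    subst hM
    rw [Matrix.trace_fin_three, Matrix.det_fin_three]
    ext i j
    fin_cases i <;> fin_cases j <;> simp [Matrix.mul_apply, Fin.sum_univ_three] <;> ring
  rw [key, htr, hdet, zero_smul, zero_smul, zero_add, add_zero]

/-- The strict inequality excludes $D=0$; any $w=Du\ne0$ works because $D^3=qD$, with $q$ the
coefficient in the statement. -/
theorem LinearMap.exists_apply_apply_eq_of_trace_eq_zero_of_det_eq_zero {V : Type*}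
    [AddCommGroup V] [Module ℝ V] (D : V →ₗ[ℝ] V) (b : Module.Basis (Fin 3) ℝ V)
    {x₁ x₂ x₃ y₁ y₂ y₃ z₁ z₂ z₃ : ℝ}
    (hM : LinearMap.toMatrix b b D = !![x₁, x₂, x₃; y₁, y₂, y₃; z₁, z₂, z₃])
    (htr : LinearMap.trace ℝ V D = 0) (hdet : LinearMap.det D = 0)
    (hneg : x₂ * y₁ - x₁ * y₂ + x₃ * z₁ - x₁ * z₃ + y₃ * z₂ - y₂ * z₃ < 0) :
    ∃ w : V, w ≠ 0 ∧ D (D w)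
      = (x₂ * y₁ - x₁ * y₂ + x₃ * z₁ - x₁ * z₃ + y₃ * z₂ - y₂ * z₃) • w := by
  have h := Matrix.mul_mul_self_eq_of_trace_eq_zero_of_det_eq_zero hM
    (by rw [← LinearMap.trace_eq_matrix_trace ℝ b D, htr]) (by rw [LinearMap.det_toMatrix, hdet])
  rw [← LinearMap.toMatrix_comp, ← LinearMap.toMatrix_comp, ← map_smul] at h
  have hD := (LinearMap.toMatrix b b).injective h
  have hne : D ≠ 0 := by
    rintro rfl
    rw [map_zero] at hM
    have h' := fun i j ↦ congrFun (congrFun hM i) j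
    have h0 := h' 0 0
    have h1 := h' 0 1
    have h2 := h' 0 2
    have h3 := h' 1 1
    have h4 := h' 1 2
    simp at h0 h1 h2 h3 h4
    subst h0 h1 h2 h3 h4
    simp at hneg
  obtain ⟨u, hu⟩ := DFunLike.ne_iff.1 hne
  exact ⟨D u, hu, by simpa using LinearMap.congr_fun hD u⟩

theorem mainTheorem7
    {G : Type*} [TopologicalSpace G] [T2Space G] [ChartedSpace (EuclideanSpace ℝ (Fin 3)) G]
    [Group G] [LieGroup (𝓡 3) ∞ G] [SimplyConnectedSpace G]
    (habelian : IsLieAbelian (GroupLieAlgebra (𝓡 3) G)) :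
    (∀ (X : (g : G) → TangentSpace (𝓡 3) g) (φ : ℝ → G → G),
      IsLinearFlow X φ →
      ∀ (b : Module.Basis (Fin 3) ℝ (GroupLieAlgebra (𝓡 3) G))
        (x₁ x₂ x₃ y₁ y₂ y₃ z₁ z₂ z₃ : ℝ),
        LinearMap.toMatrix b b (fieldDerivation X) = !![x₁, x₂, x₃; y₁, y₂, y₃; z₁, z₂, z₃] →
        LinearMap.trace ℝ _ (fieldDerivation X) = 0 →
        LinearMap.det (fieldDerivation X) = 0 →
        x₂ * y₁ - x₁ * y₂ + x₃ * z₁ - x₁ * z₃ + y₃ * z₂ - y₂ * z₃ < 0 →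
        HasPeriodicOrbit φ) ∧
    (∀ (X : (g : G) → TangentSpace (𝓡 3) g) (φ : ℝ → G → G),
      IsRightInvariant X ∨ IsLeftInvariant X → IsFlowOf X φ → ¬ HasPeriodicOrbit φ) := by
  obtain ⟨F, hF⟩ := exists_isDevelopingMap habelian
  refine ⟨fun X φ hφ b x₁ x₂ x₃ y₁ y₂ y₃ z₁ z₂ z₃ hM htr hdet hneg ↦ ?_, fun X φ hX hφ ↦ ?_⟩
  · obtain ⟨B, hB⟩ := hF.exists_developedField_eq hφ
    obtain ⟨w, hw, hDw⟩ := (fieldDerivation X).exists_apply_apply_eq_of_trace_eq_zero_of_det_eq_zero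
      b hM htr hdet hneg
    have hD := hF.fieldDerivation_eq hB
    refine hF.hasPeriodicOrbit hφ.toIsFlowOf hB (w := w) hw (neg_pos.2 hneg) ?_
    rw [neg_neg]
    exact (congrArg B (hD w)).symm.trans ((hD _).symm.trans hDw)
  · rcases hX with hX | hX
    · exact hF.not_hasPeriodicOrbit hφ (hX.developedField_eq hF)
    · exact hF.not_hasPeriodicOrbit hφ hX.developedField_eq
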